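/- A segment is a nonempty set $[b,e]=\{b,b+1,\dots,e\}$ with integers $b\le e$, and a multisegment is a finite multiset of segments; $[b,e]$ with $b>e$ denotes the empty multisegment. Two segments are linked if their union is a segment and neither contains the other. An elementary operation replaces two linked segments $\Delta,\Delta'$ of a multisegment by $\Delta\cup\Delta'$ and $\Delta\cap\Delta'$ (the latter omitted if empty). Write $\mathbf b\le\mathbf a$ if $\mathbf b$ is obtained from $\mathbf a$ by finitely many elementary operations, and $S(\mathbf a)=\{\mathbf b:\mathbf b\le\mathbf a\}$. For $k\in\mathbb Z$, let $\mathbf a^{(k)}$ be obtained from $\mathbf a$ by replacing every segment $[b,k]$ by $[b,k-1]$, and let $\deg\mathbf a$ be the sum of the cardinalities of the segments of $\mathbf a$. Let $S(\mathbf a)_k$ be the set of $\mathbf c\in S(\mathbf a)$ such that $\deg\mathbf c^{(k)}=\deg\mathbf a^{(k)}$ and $\mathbf c$ contains no two linked segments of which one ends in $k-1$ and the other in $k$. For a sequence of integers $l_1,\dots,l_m$ put $\mathbf a^{(l_1,\dots,l_m)}=(\cdots(\mathbf a^{(l_1)})^{(l_2)}\cdots)^{(l_m)}$ and $$S(\mathbf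 a)_{l_1,\dots,l_m}=\{\mathbf c\in S(\mathbf a):\ \mathbf c^{(l_1,\dots,l_i)}\in S(\mathbf a^{(l_1,\dots,l_i)})_{l_{i+1}}\text{ for }0\le i<m\}.$$ Let $S_n$ be the symmetric group with simple transpositions $\sigma_i=(i,i+1)$ and with the Bruhat order. For sets $J_1,J_2$ of simple transpositions let $S_n^{J_1,J_2}$ be the set of $w\in S_n$ with $sw>w$ for all $s\in J_1$ and $ws>w$ for all $s\in J_2$ (the minimal representatives of the double cosets of the parabolic subgroups $\langle J_1\rangle$ and $\langle J_2\rangle$), ordered by the Bruhat order of $S_n$. Let $\mathbf a_{\mathrm{Id}}^{J_1,J_2}=\{\Delta_1,\dots,\Delta_n\}$ with $\Delta_i=[b_i,e_i]$ denote any multisegment such that $b_1\le\dots\le b_n\le e_1\le\dots\le e_n$, $e_i=e_{i+1}$ if and only if $\sigma_i\in J_1$, and $b_i=b_{i+1}$ if and only if $\sigma_i\in J_2$. For $w\in S_n$ let $\mathbf a_w^{J_1,J_2}=\sum_i[b_i,e_{w(i)}]$. The elements of $S(\mathbf a_{\mathrm{Id}}^{J_1,J_2})$ are called multisegments of parabolic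 type $(J_1,J_2)$. Let $\mathbf a$ be a multisegment with $n$ segments, with beginnings $\beta_1\le\dots\le\beta_n$ and ends $\ell_1\le\dots\le\ell_n$ (listed with multiplicity). Let $J_1=J_1(\mathbf a)=\{\sigma_i:\ell_i=\ell_{i+1}\}$ and $J_2=J_2(\mathbf a)=\{\sigma_i:\beta_i=\beta_{i+1}\}$. **Theorem.** There are a multisegment $\mathbf a_{\mathrm{Id}}^{J_1,J_2}$ as above, an element $w\in S_n^{J_1,J_2}$ with $\mathbf a=\sum_j[\beta_j,\ell_{w(j)}]$, and a sequence of integers $k_1,\dots,k_r$ such that $\mathbf a_w^{J_1,J_2}$ is of parabolic type $(J_1,J_2)$ and the following hold. (1) The map $\mathbf c\mapsto\mathbf c^{(k_r,\dots,k_1)}$ is an isomorphism of posets $$S(\mathbf a_w^{J_1,J_2})_{k_r,\dots,k_1}\;\simeq\;S(\mathbf a).$$ (2) There is $\mathbf a'\in S(\mathbf a_w^{J_1,J_2})$ such that $$S(\mathbf a_w^{J_1,J_2})_{k_r,\dots,k_1}=\{\mathbf c\in S(\mathbf a_w^{J_1,J_2}):\mathbf c\ge\mathbf a'\}.$$ (3)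 Moreover $\mathbf a'=\mathbf a_{w'}^{J_1,J_2}$ for some $w'\in S_n^{J_1,J_2}$ with $w\le w'$, and $v\mapsto(\mathbf a_v^{J_1,J_2})^{(k_r,\dots,k_1)}$ is an order-reversing bijection, with order-reversing inverse, from the Bruhat interval $\{v\in S_n^{J_1,J_2}:w\le v\le w'\}$ onto $S(\mathbf a)$. -/

import Mathlib

namespace Multiseg

/-- A segment `[b, e] = {b, b + 1, …, e}` of integers, `b ≤ e`. -/
@[ext]
structure Segment where
  b : ℤ
  e : ℤ
  le : b ≤ e

/-- A multisegment is a finite multiset of (nonempty) segments. -/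
abbrev Multisegment : Type := Multiset Segment

/-- `[i, j]` as a multisegment; it is the empty multisegment if `j < i`. -/
def seg (i j : ℤ) : Multisegment :=
  if h : i ≤ j then {⟨i, j, h⟩} else 0

/-- `Δ` precedes `Δ'`: the union is a segment, neither contains the other, and `Δ` is to the
left of `Δ'`. -/
def Segment.Precedes (Δ Δ' : Segment) : Prop :=
  Δ.b < Δ'.b ∧ Δ.e < Δ'.e ∧ Δ'.b ≤ Δ.e + 1

/-- Two segments are linked if their union is a segment and neither contains the other. -/
def Segment.Linked (Δ Δ' : Segment) : Prop :=
  Δ.Precedes Δ' ∨ Δ'.Precedes Δ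

/-- `ElemOp a b`: `b` is obtained from `a` by an elementary operation, which replaces two linked
segments `Δ, Δ'` by `Δ ∪ Δ'` and `Δ ∩ Δ'` (the latter being omitted if it is empty). -/
def ElemOp (a b : Multisegment) : Prop :=
  ∃ (c : Multisegment) (Δ Δ' : Segment), Δ.Precedes Δ' ∧
    a = {Δ} + {Δ'} + c ∧ b = seg Δ.b Δ'.e + seg Δ'.b Δ.e + c

/-- The partial order on multisegments: `b ≼ a` if `b` is obtained from `a` by a finite sequence
of elementary operations. (This is not the inclusion order of `Multiset`.) -/
def Le (b a : Multisegment) : Prop := Relation.ReflTransGen ElemOp a b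

infix:50 " ≼ " => Le

/-- `S(a) = {b : b ≼ a}`. -/
def S (a : Multisegment) : Set Multisegment := {b | b ≼ a}

/-- The degree: the sum of the cardinalities `e - b + 1` of the segments. -/
def deg (a : Multisegment) : ℤ := (a.map fun Δ => Δ.e - Δ.b + 1).sum

/-- `a^(k)`: every segment `[b, k]` of `a` is replaced by `[b, k - 1]` (so `[k, k]` is dropped). -/
def trunc (k : ℤ) (a : Multisegment) : Multisegment :=
  a.bind fun Δ => if Δ.e = k then seg Δ.b (k - 1) else {Δ}

/-- `S(a)_k`: the `c ∈ S(a)` with `deg c^(k) = deg a^(k)` which contain no pair of linked segments,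
one ending in `k - 1` and the other in `k`. -/
def SOne (a : Multisegment) (k : ℤ) : Set Multisegment :=
  {c | c ∈ S a ∧ deg (trunc k c) = deg (trunc k a) ∧
    ¬ ∃ Δ ∈ c, ∃ Δ' ∈ c, Δ.e = k - 1 ∧ Δ'.e = k ∧ Δ.Linked Δ'}

/-- `a^(l₁, …, l_m) = (…(a^(l₁))^(l₂)…)^(l_m)`; the head of the list acts first. -/
def truncList : List ℤ → Multisegment → Multisegment
  | [], a => a
  | k :: ks, a => truncList ks (trunc k a)

/-- `S(a)_{l₁, …, l_m}`: the `c ∈ S(a)` with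
`c^(l₁, …, l_i) ∈ S(a^(l₁, …, l_i))_{l_{i+1}}` for all `0 ≤ i < m`. -/
def SList : List ℤ → Multisegment → Set Multisegment
  | [], a => S a
  | k :: ks, a => {c | c ∈ SOne a k ∧ trunc k c ∈ SList ks (trunc k a)}

/-- The number of inversions of a permutation, which is its Coxeter length. -/
def inv {n : ℕ} (w : Equiv.Perm (Fin n)) : ℕ :=
  (Finset.univ.filter fun p : Fin n × Fin n => p.1 < p.2 ∧ w p.2 < w p.1).card

/-- The Bruhat order on the symmetric group: the reflexive transitive closure of `u → u t` with
`t` a transposition and `ℓ(u) < ℓ(u t)`. -/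
def BruhatLE {n : ℕ} (u v : Equiv.Perm (Fin n)) : Prop :=
  Relation.ReflTransGen
    (fun x y => (∃ i j : Fin n, i ≠ j ∧ y = x * Equiv.swap i j) ∧ inv x < inv y) u v

/-- The strict Bruhat order. -/
def BruhatLT {n : ℕ} (u v : Equiv.Perm (Fin n)) : Prop := BruhatLE u v ∧ u ≠ v

/-- The simple transposition exchanging the `i`-th and the `(i+1)`-st element of `Fin n`. -/
def simpleRefl {n : ℕ} (i : ℕ) (h : i + 1 < n) : Equiv.Perm (Fin n) :=
  Equiv.swap ⟨i, Nat.lt_of_succ_lt h⟩ ⟨i + 1, h⟩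

/-- `S_n^{J₁, J₂}`, the set of `w` with `s w > w` for `s ∈ J₁` and `w s > w` for `s ∈ J₂`. If
`J₁, J₂` consist of simple transpositions, these are the elements of minimal length in the double
cosets of the parabolic subgroups generated by `J₁` and `J₂`. -/
def doubleReps {n : ℕ} (J₁ J₂ : Set (Equiv.Perm (Fin n))) : Set (Equiv.Perm (Fin n)) :=
  {w | (∀ s ∈ J₁, BruhatLT w (s * w)) ∧ ∀ s ∈ J₂, BruhatLT w (w * s)}

/-- The segments `Δ_i = [b i, e i]` of a multisegment `a_Id^{J₁, J₂}`. -/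
structure ParabolicFrame (n : ℕ) (J₁ J₂ : Set (Equiv.Perm (Fin n))) where
  b : Fin n → ℤ
  e : Fin n → ℤ
  mono_e : Monotone e
  e_eq_iff : ∀ (i : ℕ) (h : i + 1 < n),
    e ⟨i, Nat.lt_of_succ_lt h⟩ = e ⟨i + 1, h⟩ ↔ simpleRefl i h ∈ J₁
  mono_b : Monotone b
  b_eq_iff : ∀ (i : ℕ) (h : i + 1 < n),
    b ⟨i, Nat.lt_of_succ_lt h⟩ = b ⟨i + 1, h⟩ ↔ simpleRefl i h ∈ J₂
  b_le_e : ∀ i j, b i ≤ e j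

/-- The multisegment `∑ i, [b i, e (w i)]`. -/
def ofPerm {n : ℕ} (b e : Fin n → ℤ) (w : Equiv.Perm (Fin n)) : Multisegment :=
  ∑ i, seg (b i) (e (w i))

/-- `a_w^{J₁, J₂} = ∑ i, [b(Δ_i), e(Δ_{w(i)})]`. -/
def ParabolicFrame.multiseg {n : ℕ} {J₁ J₂ : Set (Equiv.Perm (Fin n))}
    (P : ParabolicFrame n J₁ J₂) (w : Equiv.Perm (Fin n)) : Multisegment :=
  ofPerm P.b P.e w

/-- The beginnings `k_1 ≤ … ≤ k_r` of the segments of `a`, with multiplicity. -/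
def beg (a : Multisegment) (i : Fin a.card) : ℤ :=
  ((a.map Segment.b).sort (· ≤ ·)).get (i.cast (by simp))

/-- The ends `ℓ_1 ≤ … ≤ ℓ_r` of the segments of `a`, with multiplicity. -/
def fin (a : Multisegment) (i : Fin a.card) : ℤ :=
  ((a.map Segment.e).sort (· ≤ ·)).get (i.cast (by simp))

/-- `J₁(a)`: the simple transpositions `σ_i` with `ℓ_i = ℓ_{i+1}`. -/
def J₁ (a : Multisegment) : Set (Equiv.Perm (Fin a.card)) :=
  {s | ∃ (i : ℕ) (h : i + 1 < a.card), s = simpleRefl i h ∧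
    fin a ⟨i, Nat.lt_of_succ_lt h⟩ = fin a ⟨i + 1, h⟩}

/-- `J₂(a)`: the simple transpositions `σ_i` with `k_i = k_{i+1}`. -/
def J₂ (a : Multisegment) : Set (Equiv.Perm (Fin a.card)) :=
  {s | ∃ (i : ℕ) (h : i + 1 < a.card), s = simpleRefl i h ∧
    beg a ⟨i, Nat.lt_of_succ_lt h⟩ = beg a ⟨i + 1, h⟩}

end Multiseg

namespace Multiseg

open Finset Equiv

variable {n : ℕ}

/-! ### The Bruhat order and rank functions -/

/-! Let `β`, `ℓ` be the sorted beginnings and ends of `a`. Every element of `S a` has the form `∑ [β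
i, ℓ (u i)]` with `u` admissible, that is `β i ≤ ℓ (u i) + 1`; equality means that the segment has
been used up, and anything smaller would lose degree. An elementary operation multiplies `u` by a
transposition that adds inversions, so the order on multisegments reverses the Bruhat order.

The multisegment sees `u` only through the multiset `pairs β ℓ u`, so minimal representatives
suffice. The Bruhat order is given by rank inequalities (`BruhatLE.rk_le`, `bruhatLE_of_rk_le`), and
below a minimal `u` it is enough to test ranks at the level boundaries of `β` and `ℓ`
(`IsMinRep.bruhatLE`), where they depend only on `pairs`. This yields `IsMinRep.ofPerm_le_iff`.
Admissibility passes to smaller elements, and a largest admissible representative `w'` exists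
(`exists_greatest_admissible`), so `S a` is the interval `[w, w']` reversed.

For the frame, all ends are moved far to the right, so that every permutation becomes admissible.
Truncations bring the ends back, one value at a time into a free place (`TruncChain`). The
linkedness condition is then vacuous, and the degree conditions say exactly that `u` is admissible
for the original ends (`TruncChain.SList_ofPerm`). Both sides are thus parametrized by the same
interval. -/

/-- The number of positions `a ≤ i` with `j ≤ w a`. -/
def rk (w : Perm (Fin n)) (i : Fin n) (j : ℕ) : ℕ :=
  #{a | a ≤ i ∧ j ≤ (w a : ℕ)}

theorem sum_eq_pair_add {M : Type*} [AddCommMonoid M] (F : Fin n → Fin n → M) (u : Perm (Fin n))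
    {a b : Fin n} (hab : a ≠ b) :
    ∑ c, F c (u c) = F a (u a) + F b (u b) + ∑ c ∈ (univ.erase a).erase b, F c (u c) := by
  rw [← Finset.add_sum_erase univ _ (mem_univ a),
    ← Finset.add_sum_erase (univ.erase a) _ (mem_erase.2 ⟨hab.symm, mem_univ b⟩), add_assoc]

theorem sum_mul_swap {M : Type*} [AddCommMonoid M] (F : Fin n → Fin n → M) (u : Perm (Fin n))
    {a b : Fin n} (hab : a ≠ b) :
    ∑ c, F c ((u * swap a b) c) =
      F a (u b) + F b (u a) + ∑ c ∈ (univ.erase a).erase b, F c (u c) := by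
  rw [sum_eq_pair_add F _ hab]
  simp only [Perm.mul_apply, swap_apply_left, swap_apply_right]
  congr 1
  refine sum_congr rfl fun c hc => ?_
  rw [mem_erase, mem_erase] at hc
  rw [swap_apply_of_ne_of_ne hc.2.1 hc.1]

theorem rk_eq_sum (w : Perm (Fin n)) (i : Fin n) (j : ℕ) :
    rk w i j = ∑ a, (fun (a x : Fin n) => if a ≤ i ∧ j ≤ (x : ℕ) then 1 else 0) a (w a) := by
  rw [rk, card_filter]

theorem rk_mul_swap (u : Perm (Fin n)) {a b : Fin n} (hab : a < b) (h : u a < u b)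
    (i : Fin n) (j : ℕ) :
    rk (u * swap a b) i j =
      rk u i j + if a ≤ i ∧ i < b ∧ (u a : ℕ) < j ∧ j ≤ (u b : ℕ) then 1 else 0 := by
  let F : Fin n → Fin n → ℕ := fun a x => if a ≤ i ∧ j ≤ (x : ℕ) then 1 else 0
  have h1 := sum_mul_swap F u hab.ne
  have h2 := sum_eq_pair_add F u hab.ne
  rw [rk_eq_sum, rk_eq_sum, h1, h2]
  simp only [F]
  have h' : (u a : ℕ) < u b := h
  have hab' : (a : ℕ) < b := hab
  simp only [Fin.le_def, Fin.lt_def]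
  split_ifs <;> omega

/-- Inversions of `u` inject into those of `u * swap i j`: apply the swap to both positions if their
order survives, otherwise keep the pair. The new inversion `(i, j)` is missed. -/
theorem inv_lt_inv_mul_swap (u : Perm (Fin n)) {i j : Fin n} (hij : i < j) (h : u i < u j) :
    inv u < inv (u * swap i j) := by
  set t := swap i j with ht
  have htt : ∀ p, t (t p) = p := fun p => swap_apply_self i j p
  let φ : Fin n × Fin n → Fin n × Fin n := fun p => if t p.1 < t p.2 then (t p.1, t p.2) else p
  set A := univ.filter fun p : Fin n × Fin n => p.1 < p.2 ∧ u p.2 < u p.1 with hA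
  set B := univ.filter fun p : Fin n × Fin n => p.1 < p.2 ∧ (u * t) p.2 < (u * t) p.1 with hB
  have hmaps : A.image φ ⊆ B.erase (i, j) := by
    intro x hx
    obtain ⟨⟨p, q⟩, hp, rfl⟩ := mem_image.1 hx
    simp only [hA, mem_filter, mem_univ, true_and] at hp
    simp only [hB, mem_erase, mem_filter, mem_univ, true_and, φ]
    by_cases hpq : t p < t q
    · simp only [hpq, if_true, Perm.mul_apply, htt, hp.2, and_true]
      intro he
      have h1 : p = j := by rw [← htt p, (Prod.mk.inj he).1, ht, swap_apply_left]
      have h2 : q = i := by rw [← htt q, (Prod.mk.inj he).2, ht, swap_apply_right]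
      subst h1 h2
      exact absurd hij hp.1.asymm
    · simp only [hpq, if_false, Perm.mul_apply, hp.1, true_and]
      have hne : (p, q) ≠ (i, j) := by
        rintro he
        obtain ⟨rfl, rfl⟩ := Prod.mk.inj he
        exact absurd h hp.2.asymm
      refine ⟨hne, ?_⟩
      have hp1 := hp.1
      have hp2 := hp.2
      simp only [ht, swap_apply_def] at hpq ⊢
      clear_value A B
      split_ifs at hpq ⊢ <;> subst_vars <;> first | exact hp2 | (exfalso; simp_all; done) | order
  have hinj : Set.InjOn φ A := by
    rintro ⟨p, q⟩ hp ⟨p', q'⟩ hp' he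
    simp only [hA, coe_filter, Set.mem_ofPred_eq, mem_univ, true_and] at hp hp'
    simp only [φ] at he
    split_ifs at he with h1 h2 h2
    · obtain ⟨e1, e2⟩ := Prod.mk.inj he
      rw [t.injective e1, t.injective e2]
    · obtain ⟨rfl, rfl⟩ := Prod.mk.inj he
      simp only [htt] at h2
      exact absurd hp.1 h2
    · obtain ⟨rfl, rfl⟩ := Prod.mk.inj he
      simp only [htt] at h1
      exact absurd hp'.1 h1
    · exact he
  have hmem : (i, j) ∈ B := by simp [hB, ht, hij, h]
  calc inv u = #A := rfl
    _ = #(A.image φ) := (card_image_of_injOn hinj).symm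
    _ ≤ #(B.erase (i, j)) := card_le_card hmaps
    _ < #B := card_erase_lt_of_mem hmem

theorem exists_lt_of_bruhat_step {x y : Perm (Fin n)}
    (h : (∃ i j : Fin n, i ≠ j ∧ y = x * swap i j) ∧ inv x < inv y) :
    ∃ i j : Fin n, i < j ∧ x i < x j ∧ y = x * swap i j := by
  obtain ⟨⟨i, j, hij, rfl⟩, hinv⟩ := h
  wlog hlt : i < j generalizing i j
  · rw [swap_comm] at hinv ⊢
    exact this j i hij.symm hinv (lt_of_le_of_ne (not_lt.1 hlt) hij.symm)
  refine ⟨i, j, hlt, ?_, rfl⟩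
  by_contra hx
  have hx' : (x * swap i j) i < (x * swap i j) j := by
    simpa using lt_of_le_of_ne (not_lt.1 hx) (x.injective.ne hij.symm)
  have := inv_lt_inv_mul_swap _ hlt hx'
  rw [mul_assoc, swap_mul_self, mul_one] at this
  omega

theorem BruhatLE.single (x : Perm (Fin n)) {i j : Fin n} (hij : i < j) (h : x i < x j) :
    BruhatLE x (x * swap i j) :=
  Relation.ReflTransGen.single ⟨⟨i, j, hij.ne, rfl⟩, inv_lt_inv_mul_swap x hij h⟩

theorem BruhatLE.rk_le {u v : Perm (Fin n)} (h : BruhatLE u v) (i : Fin n) (j : ℕ) :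
    rk u i j ≤ rk v i j := by
  induction h with
  | refl => exact le_rfl
  | tail _ hs ih =>
    obtain ⟨p, q, hpq, hx, rfl⟩ := exists_lt_of_bruhat_step hs
    rw [rk_mul_swap _ hpq hx]
    omega

/-- Take `a` to be the first position where `u` and `v` differ; the ranks force `u a < v a`. Let `b`
be the first later position with `u a < u b ≤ v a`. The swap raises the rank of `u` by one on a
rectangle only, and there the inequality with `v` was strict. -/
theorem exists_swap_of_rk_le {u v : Perm (Fin n)} (h : ∀ i j, rk u i j ≤ rk v i j) (hne : u ≠ v) :
    ∃ a b, a < b ∧ u a < u b ∧ ∀ i j, rk (u * swap a b) i j ≤ rk v i j := by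
  have hex : ∃ a, u a ≠ v a := by
    by_contra hc
    exact hne (Equiv.ext fun a => by_contra fun ha => hc ⟨a, ha⟩)
  obtain ⟨a, ha, hamin⟩ := WellFounded.has_min (wellFounded_lt (α := Fin n)) {a | u a ≠ v a} hex
  have hlow : ∀ c, c < a → u c = v c := fun c hc => by_contra fun hc' => hamin c hc' hc
  have hav : u a < v a := by
    refine lt_of_le_of_ne (not_lt.1 fun hlt => ?_) ha
    have : rk v a (u a) < rk u a (u a) := by
      refine card_lt_card
        ((ssubset_iff_of_subset fun c hc => ?_).2 ⟨a, by simp, by simpa using hlt⟩)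
      simp only [mem_filter, mem_univ, true_and] at hc ⊢
      rcases hc.1.lt_or_eq with hca | rfl
      · rw [hlow c hca]; exact hc
      · exact absurd hc.2 (not_le.2 hlt)
    exact absurd (h a (u a)) (not_le.2 this)
  have hb : ∃ b, a < b ∧ u a < u b ∧ u b ≤ v a := by
    refine ⟨u.symm (v a), ?_, by simpa using hav, by simp⟩
    by_contra hle
    rcases (not_lt.1 hle).lt_or_eq with hlt | heq
    · have h1 := hlow _ hlt
      rw [apply_symm_apply] at h1
      exact hlt.ne (v.injective h1.symm)
    · rw [symm_apply_eq] at heq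
      exact ha heq.symm
  obtain ⟨b, ⟨hab, hub, hbv⟩, hbmin⟩ :=
    WellFounded.has_min (wellFounded_lt (α := Fin n)) {b | a < b ∧ u a < u b ∧ u b ≤ v a} hb
  refine ⟨a, b, hab, hub, fun i j => ?_⟩
  rw [rk_mul_swap u hab hub]
  split_ifs with hc
  swap
  · exact h i j
  obtain ⟨hai, hib, huj, hjb⟩ := hc
  -- By minimality of `b`, the values of `u` in `[j, v a]` at positions up to `i` all occur before
  -- `a`, where `u = v`. For `v` there is in addition the position `a`, which gives the strict
  -- inequality when compared with the ranks at `v a + 1`.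
  let X : Finset (Fin n) := {c | c < a ∧ j ≤ (v c : ℕ) ∧ v c ≤ v a}
  have h1 : rk u i j ≤ rk u i (v a + 1) + #X := by
    refine (card_le_card fun c hc => ?_).trans (card_union_le _ _)
    simp only [X, mem_union, mem_filter, mem_univ, true_and] at hc ⊢
    rcases lt_or_ge (v a) (u c) with hlt | hle
    · exact Or.inl ⟨hc.1, hlt⟩
    · right
      rcases lt_trichotomy c a with hca | rfl | hca
      · rw [← hlow c hca]
        exact ⟨hca, hc.2, hle⟩
      · omega
      · exact absurd (hc.1.trans_lt hib) (hbmin c ⟨hca, Fin.lt_def.2 (by omega), hle⟩)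
  have h2 : rk v i (v a + 1) + (#X + 1) ≤ rk v i j := by
    have haX : a ∉ X := by simp [X]
    rw [← card_insert_of_notMem haX, rk, ← card_union_of_disjoint]
    · refine card_le_card fun c hc => ?_
      have hbv' : (u b : ℕ) ≤ v a := hbv
      simp only [X, mem_union, mem_insert, mem_filter, mem_univ, true_and] at hc ⊢
      rcases hc with hc | rfl | hc
      · exact ⟨hc.1, by omega⟩
      · exact ⟨hai, by omega⟩
      · exact ⟨hc.1.le.trans hai, hc.2.1⟩
    · rw [Finset.disjoint_left]
      intro c hc hc'
      simp only [X, mem_insert, mem_filter, mem_univ, true_and] at hc hc'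
      rcases hc' with rfl | hc'
      · omega
      · have : (v c : ℕ) ≤ v a := hc'.2.2
        omega
  have := h i (v a + 1)
  omega

theorem inv_le (w : Perm (Fin n)) : inv w ≤ n * n := by
  simpa [inv] using card_filter_le (univ : Finset (Fin n × Fin n))
    (fun p => p.1 < p.2 ∧ w p.2 < w p.1)

theorem bruhatLE_of_rk_le (u v : Perm (Fin n)) (h : ∀ i j, rk u i j ≤ rk v i j) :
    BruhatLE u v := by
  by_cases hne : u = v
  · exact hne ▸ Relation.ReflTransGen.refl
  obtain ⟨a, b, hab, hu, hr⟩ := exists_swap_of_rk_le h hne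
  have := inv_lt_inv_mul_swap u hab hu
  have := inv_le (u * swap a b)
  exact (BruhatLE.single u hab hu).trans (bruhatLE_of_rk_le (u * swap a b) v hr)
termination_by n * n - inv u

theorem one_bruhatLE (w : Perm (Fin n)) : BruhatLE 1 w := by
  refine bruhatLE_of_rk_le _ _ fun i j => ?_
  rcases lt_or_ge (i : ℕ) j with hij | hij
  · refine (card_eq_zero.2 (filter_eq_empty_iff.2 fun c _ hc => ?_)).trans_le (Nat.zero_le _)
    have h1 : (c : ℕ) ≤ i := hc.1
    have h2 : j ≤ (c : ℕ) := hc.2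
    omega
  -- Only `j` values lie below `j`, so at least `i + 1 - j` of the first `i + 1` positions carry a
  -- value `≥ j`; the identity attains this bound.
  have h1 : rk 1 i j + #{a : Fin n | (a : ℕ) < j} ≤ #{a : Fin n | a ≤ i} := by
    rw [rk, ← card_union_of_disjoint]
    · refine card_le_card fun c hc => ?_
      simp only [mem_union, mem_filter, mem_univ, true_and] at hc ⊢
      rcases hc with hc | hc
      · exact hc.1
      · exact Fin.le_def.2 (by omega)
    · rw [Finset.disjoint_left]
      intro c hc hc'
      have h1 : j ≤ (c : ℕ) := (mem_filter.1 hc).2.2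
      have h2 : (c : ℕ) < j := (mem_filter.1 hc').2
      omega
  have h2 : #{a : Fin n | a ≤ i} ≤ rk w i j + #{a : Fin n | (w a : ℕ) < j} := by
    refine (card_le_card fun c hc => ?_).trans (card_union_le _ _)
    simp only [mem_union, mem_filter, mem_univ, true_and] at hc ⊢
    exact (le_or_gt j (w c : ℕ)).imp (fun h => ⟨hc, h⟩) id
  have h3 : #{a : Fin n | (w a : ℕ) < j} = #{a : Fin n | (a : ℕ) < j} :=
    card_equiv w fun a => by simp
  omega

/-! ### Minimal representatives -/

/-- The multiset of the pairs `(β i, ℓ (u i))`. -/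
def pairs (β ℓ : Fin n → ℤ) (u : Perm (Fin n)) : Multiset (ℤ × ℤ) :=
  univ.val.map fun i => (β i, ℓ (u i))

/-- `u` is increasing on the level sets of `β`, and `u⁻¹` on those of `ℓ`. -/
def IsMinRep (β ℓ : Fin n → ℤ) (u : Perm (Fin n)) : Prop :=
  (∀ i j, i < j → β i = β j → u i < u j) ∧ ∀ i j, i < j → ℓ i = ℓ j → u.symm i < u.symm j

theorem pairs_mul_swap {β : Fin n → ℤ} (ℓ : Fin n → ℤ) (u : Perm (Fin n)) {i j : Fin n}
    (h : β i = β j) : pairs β ℓ (u * swap i j) = pairs β ℓ u := by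
  have hβ : ∀ c, β (swap i j c) = β c := fun c => by
    rw [swap_apply_def]
    split_ifs with h1 h2
    · rw [h1, h]
    · rw [h2, h]
    · rfl
  have h1 : pairs β ℓ (u * swap i j) =
      (univ.val.map (swap i j)).map fun i => (β i, ℓ (u i)) := by
    rw [Multiset.map_map]
    exact Multiset.map_congr rfl fun c _ => by simp [hβ]
  rw [h1, Multiset.map_univ_val_equiv]
  rfl

theorem pairs_swap_mul (β : Fin n → ℤ) {ℓ : Fin n → ℤ} (u : Perm (Fin n)) {i j : Fin n}
    (h : ℓ i = ℓ j) : pairs β ℓ (swap i j * u) = pairs β ℓ u := by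
  refine Multiset.map_congr rfl fun c _ => ?_
  rw [Perm.mul_apply, swap_apply_def]
  split_ifs with h1 h2
  · rw [h1, h]
  · rw [h2, h]
  · rfl

theorem swap_mul_eq_mul_swap_symm (u : Perm (Fin n)) (i j : Fin n) :
    swap i j * u = u * swap (u.symm i) (u.symm j) := by
  rw [mul_swap_eq_swap_mul, apply_symm_apply, apply_symm_apply]

/-- A permutation with fewest inversions among those with the given pairs works: swaps inside a
level set preserve the pairs, so they cannot shorten it. -/
theorem exists_isMinRep (β ℓ : Fin n → ℤ) (u : Perm (Fin n)) :
    ∃ v, IsMinRep β ℓ v ∧ pairs β ℓ v = pairs β ℓ u := by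
  obtain ⟨v, hv, hmin⟩ := WellFounded.has_min (measure (inv (n := n))).wf
    {v | pairs β ℓ v = pairs β ℓ u} ⟨u, rfl⟩
  have key : ∀ i j, i < j → pairs β ℓ (v * swap i j) = pairs β ℓ v → v i < v j := by
    intro i j hij h
    by_contra hlt
    refine hmin (v * swap i j) (h.trans hv) ?_
    have := inv_lt_inv_mul_swap (v * swap i j) hij
      (by simpa using lt_of_le_of_ne (not_lt.1 hlt) (v.injective.ne hij.ne'))
    rwa [mul_assoc, swap_mul_self, mul_one] at this
  refine ⟨v, ⟨fun i j hij h => key i j hij (pairs_mul_swap ℓ v h), fun i j hij h => ?_⟩, hv⟩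
  by_contra hlt
  have hlt' := lt_of_le_of_ne (not_lt.1 hlt) (v.symm.injective.ne hij.ne')
  have := key _ _ hlt' (by rw [← swap_mul_eq_mul_swap_symm, pairs_swap_mul β v h.symm])
  rw [apply_symm_apply, apply_symm_apply] at this
  exact this.asymm hij

/-- The number of `a` with `β a ≤ x` and `y ≤ ℓ (u a)`. -/
def levelRk (β ℓ : Fin n → ℤ) (u : Perm (Fin n)) (x y : ℤ) : ℕ :=
  #{a | β a ≤ x ∧ y ≤ ℓ (u a)}

theorem levelRk_congr {β ℓ : Fin n → ℤ} {u v : Perm (Fin n)} (h : pairs β ℓ u = pairs β ℓ v) :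
    levelRk β ℓ u = levelRk β ℓ v := by
  have key : ∀ u x y, levelRk β ℓ u x y =
      ((pairs β ℓ u).filter fun p => p.1 ≤ x ∧ y ≤ p.2).card := fun u x y => by
    rw [pairs, Multiset.filter_map, Multiset.card_map]
    rfl
  funext x y
  rw [key, key, h]

/-- Comparison of the numbers of elements of two sets in an initial interval, if the first set
meets each level set of `f` in a final part. -/
theorem card_filter_le_of_levels {α : Type*} [LinearOrder α] [Fintype α] {f : α → ℤ}
    (hf : Monotone f) {T T' : Finset α} (hT : ∀ p q, p < q → f p = f q → p ∈ T → q ∈ T)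
    (h : ∀ x, #{a ∈ T | f a ≤ x} ≤ #{a ∈ T' | f a ≤ x}) (i : α) :
    #{a ∈ T | a ≤ i} ≤ #{a ∈ T' | a ≤ i} := by
  -- If `T` meets the level of `i` at or before `i`, it contains everything in that level after `i`,
  -- so the comparison at `f i` loses nothing for `T`. Otherwise the comparison at `f i - 1`
  -- suffices.
  by_cases hA : ∃ a ∈ T, a ≤ i ∧ f a = f i
  · obtain ⟨a, haT, hai, hfa⟩ := hA
    let B : Finset α := {c | i < c ∧ f c = f i}
    have h1 : #{a ∈ T | a ≤ i} + #B ≤ #{a ∈ T | f a ≤ f i} := by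
      rw [← card_union_of_disjoint]
      · refine card_le_card fun c hc => ?_
        simp only [B, mem_union, mem_filter, mem_univ, true_and] at hc ⊢
        rcases hc with hc | hc
        · exact ⟨hc.1, hf hc.2⟩
        · exact ⟨hT a c (hai.trans_lt hc.1) (hfa.trans hc.2.symm) haT, hc.2.le⟩
      · rw [Finset.disjoint_left]
        intro c hc hc'
        exact absurd (mem_filter.1 hc).2 (not_le.2 (mem_filter.1 hc').2.1)
    have h2 : #{a ∈ T' | f a ≤ f i} ≤ #{a ∈ T' | a ≤ i} + #B := by
      refine (card_le_card fun c hc => ?_).trans (card_union_le _ _)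
      simp only [B, mem_union, mem_filter, mem_univ, true_and] at hc ⊢
      rcases le_or_gt c i with hci | hci
      · exact Or.inl ⟨hc.1, hci⟩
      · exact Or.inr ⟨hci, le_antisymm hc.2 (hf hci.le)⟩
    have := h (f i)
    omega
  · calc #{a ∈ T | a ≤ i} ≤ #{a ∈ T | f a ≤ f i - 1} := by
          refine card_le_card fun c hc => ?_
          simp only [mem_filter] at hc ⊢
          refine ⟨hc.1, Int.le_sub_one_of_lt (lt_of_le_of_ne (hf hc.2) fun he => ?_)⟩
          exact hA ⟨c, hc.1, hc.2, he⟩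
      _ ≤ #{a ∈ T' | f a ≤ f i - 1} := h _
      _ ≤ #{a ∈ T' | a ≤ i} := by
          refine card_le_card fun c hc => ?_
          simp only [mem_filter] at hc ⊢
          refine ⟨hc.1, le_of_not_gt fun hci => ?_⟩
          have := hf hci.le
          omega

/-- The rank inequalities are refined from level boundaries to all cut-offs, first in the values (by
monotonicity of `u⁻¹` on levels of `ℓ`), then in the positions. Only the smaller element has to be
minimal. -/
theorem IsMinRep.bruhatLE {β ℓ : Fin n → ℤ} (hβ : Monotone β) (hℓ : Monotone ℓ)
    {u v : Perm (Fin n)} (hu : IsMinRep β ℓ u) (h : ∀ x y, levelRk β ℓ u x y ≤ levelRk β ℓ v x y) :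
    BruhatLE u v := by
  have h1 : ∀ (x : ℤ) (j : Fin n),
      #{a | β a ≤ x ∧ j ≤ u a} ≤ #{a | β a ≤ x ∧ j ≤ v a} := by
    intro x j
    -- Values are counted from above, so the lemma on initial intervals is applied in the dual order
    -- with `-ℓ`.
    have tr : ∀ u : Perm (Fin n), ∀ p : Fin n → Prop, ∀ [DecidablePred p],
        #{a | β a ≤ x ∧ p (u a)} =
          #{c ∈ ({c | β (u.symm (OrderDual.ofDual c)) ≤ x} : Finset (Fin n)ᵒᵈ) |
            p (OrderDual.ofDual c)} := by
      intro u p _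
      rw [filter_filter]
      exact card_equiv (u.trans OrderDual.toDual) fun a => by simp
    rw [tr u (fun c => j ≤ c), tr v (fun c => j ≤ c)]
    refine card_filter_le_of_levels (f := fun c => -ℓ (OrderDual.ofDual c))
      (fun p q hpq => neg_le_neg (hℓ hpq)) ?_ ?_ (OrderDual.toDual j)
    · intro p q hpq hf hp
      simp only [mem_filter, mem_univ, true_and] at hp ⊢
      exact (hβ (hu.2 _ _ hpq (neg_injective hf).symm).le).trans hp
    · intro y
      have hy := h x (-y)
      rw [levelRk, levelRk, tr u (fun c => -y ≤ ℓ c), tr v (fun c => -y ≤ ℓ c)] at hy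
      simpa only [neg_le] using hy
  refine bruhatLE_of_rk_le u v fun i j => ?_
  rcases lt_or_ge j n with hj | hj
  swap
  · refine (card_eq_zero.2 (filter_eq_empty_iff.2 fun c _ hc => ?_)).trans_le (Nat.zero_le _)
    have := (u c).2
    omega
  have tr : ∀ u : Perm (Fin n), ∀ p : Fin n → Prop, ∀ [DecidablePred p],
      #{a ∈ ({a | (⟨j, hj⟩ : Fin n) ≤ u a} : Finset (Fin n)) | p a} =
        #{a | p a ∧ (⟨j, hj⟩ : Fin n) ≤ u a} := by
    intro u p _
    rw [filter_filter]
    simp only [and_comm]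
  have := card_filter_le_of_levels hβ (T := {a | (⟨j, hj⟩ : Fin n) ≤ u a})
    (T' := {a | (⟨j, hj⟩ : Fin n) ≤ v a}) ?_ ?_ i
  · rw [tr, tr] at this
    exact this
  · intro p q hpq hf hp
    simp only [mem_filter, mem_univ, true_and] at hp ⊢
    exact hp.trans (hu.1 p q hpq hf).le
  · intro x
    rw [tr, tr]
    exact h1 x _

theorem levelRk_mul_swap_le {β ℓ : Fin n → ℤ} (hβ : Monotone β) (hℓ : Monotone ℓ)
    (u : Perm (Fin n)) {i j : Fin n} (hij : i < j) (hu : u i < u j) (x y : ℤ) :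
    levelRk β ℓ u x y ≤ levelRk β ℓ (u * swap i j) x y := by
  let F : Fin n → Fin n → ℕ := fun a c => if β a ≤ x ∧ y ≤ ℓ c then 1 else 0
  have key : ∀ u, levelRk β ℓ u x y = ∑ a, F a (u a) := fun u => by rw [levelRk, card_filter]
  rw [key, key, sum_mul_swap F u hij.ne, sum_eq_pair_add F u hij.ne]
  have h1 := hβ hij.le
  have h2 := hℓ hu.le
  simp only [F]
  split_ifs <;> omega

theorem BruhatLE.levelRk_le {β ℓ : Fin n → ℤ} (hβ : Monotone β) (hℓ : Monotone ℓ)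
    {u v : Perm (Fin n)} (h : BruhatLE u v) (x y : ℤ) :
    levelRk β ℓ u x y ≤ levelRk β ℓ v x y := by
  induction h with
  | refl => exact le_rfl
  | tail _ hs ih =>
    obtain ⟨p, q, hpq, hx, rfl⟩ := exists_lt_of_bruhat_step hs
    exact ih.trans (levelRk_mul_swap_le hβ hℓ _ hpq hx x y)

theorem BruhatLE.congr_right {β ℓ : Fin n → ℤ} (hβ : Monotone β) (hℓ : Monotone ℓ)
    {u v v' : Perm (Fin n)} (hu : IsMinRep β ℓ u) (h : BruhatLE u v)
    (hv : pairs β ℓ v' = pairs β ℓ v) : BruhatLE u v' :=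
  hu.bruhatLE hβ hℓ fun x y => by
    rw [levelRk_congr hv]
    exact h.levelRk_le hβ hℓ x y

theorem IsMinRep.eq_of_pairs_eq {β ℓ : Fin n → ℤ} (hβ : Monotone β) (hℓ : Monotone ℓ)
    {u v : Perm (Fin n)} (hu : IsMinRep β ℓ u) (hv : IsMinRep β ℓ v)
    (h : pairs β ℓ u = pairs β ℓ v) : u = v := by
  have h1 : BruhatLE u v := BruhatLE.congr_right hβ hℓ hu Relation.ReflTransGen.refl h.symm
  have h2 : BruhatLE v u := BruhatLE.congr_right hβ hℓ hv Relation.ReflTransGen.refl h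
  by_contra hne
  have hinv : ∀ {x y : Perm (Fin n)}, BruhatLE x y → inv x ≤ inv y := fun h => by
    induction h with
    | refl => exact le_rfl
    | tail _ hs ih => exact ih.trans hs.2.le
  rcases Relation.ReflTransGen.cases_head h1 with he | ⟨c, hc, hcv⟩
  · exact hne he
  · have := hc.2
    have := hinv hcv
    have := hinv h2
    omega

/-! ### Minimal representatives and double cosets -/

theorem strictMono_on_levels {β : Fin n → ℤ} (hβ : Monotone β) {f : Fin n → Fin n}
    (h : ∀ (i : ℕ) (hi : i + 1 < n), β ⟨i, Nat.lt_of_succ_lt hi⟩ = β ⟨i + 1, hi⟩ →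
      f ⟨i, Nat.lt_of_succ_lt hi⟩ < f ⟨i + 1, hi⟩) (i j : Fin n) (hij : i < j) (he : β i = β j) :
    f i < f j := by
  obtain ⟨j, hj⟩ := j
  induction j with
  | zero => exact absurd hij (Nat.not_lt_zero _)
  | succ j ih =>
    have hle : i ≤ ⟨j, Nat.lt_of_succ_lt hj⟩ := Nat.lt_succ_iff.1 hij
    have h1 : (⟨j, Nat.lt_of_succ_lt hj⟩ : Fin n) ≤ ⟨j + 1, hj⟩ := Nat.le_succ j
    have e1 : β i = β ⟨j, Nat.lt_of_succ_lt hj⟩ := le_antisymm (hβ hle) (he ▸ hβ h1)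
    have h2 := h j hj (e1 ▸ he)
    rcases hle.lt_or_eq with hlt | heq
    · exact (ih _ hlt e1).trans h2
    · rwa [heq]

theorem BruhatLT.lt_of_mul_swap {w : Perm (Fin n)} {i j : Fin n} (hij : i < j)
    (h : BruhatLT w (w * swap i j)) : w i < w j := by
  by_contra hlt
  have hlt' := lt_of_le_of_ne (not_lt.1 hlt) (w.injective.ne hij.ne')
  -- The point `(i, w i)` lies in the rectangle where undoing the swap raises the rank, so the rank
  -- of `w` would exceed that of `w * swap i j`.
  have := rk_mul_swap (w * swap i j) hij (by simpa using hlt') i (w i)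
  rw [mul_assoc, swap_mul_self, mul_one, if_pos] at this
  · have := h.1.rk_le i (w i)
    omega
  · simpa using ⟨hij, hlt'⟩

theorem BruhatLT.mul_swap {w : Perm (Fin n)} {i j : Fin n} (hij : i < j) (h : w i < w j) :
    BruhatLT w (w * swap i j) := by
  refine ⟨BruhatLE.single w hij h, fun he => ?_⟩
  have := inv_lt_inv_mul_swap w hij h
  rw [← he] at this
  omega

theorem mem_doubleReps_iff {β ℓ : Fin n → ℤ} (hβ : Monotone β) (hℓ : Monotone ℓ)
    (u : Perm (Fin n)) :
    u ∈ doubleReps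
        {s | ∃ (i : ℕ) (h : i + 1 < n), s = simpleRefl i h ∧
          ℓ ⟨i, Nat.lt_of_succ_lt h⟩ = ℓ ⟨i + 1, h⟩}
        {s | ∃ (i : ℕ) (h : i + 1 < n), s = simpleRefl i h ∧
          β ⟨i, Nat.lt_of_succ_lt h⟩ = β ⟨i + 1, h⟩} ↔
      IsMinRep β ℓ u := by
  have hlt : ∀ (i : ℕ) (hi : i + 1 < n), (⟨i, Nat.lt_of_succ_lt hi⟩ : Fin n) < ⟨i + 1, hi⟩ :=
    fun i _ => Nat.lt_succ_self i
  constructor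
  · rintro ⟨h1, h2⟩
    refine ⟨strictMono_on_levels hβ fun i hi he => ?_, strictMono_on_levels hℓ fun i hi he => ?_⟩
    · exact BruhatLT.lt_of_mul_swap (hlt i hi) (h2 _ ⟨i, hi, rfl, he⟩)
    · by_contra hc
      have hc' := lt_of_le_of_ne (not_lt.1 hc) (u.symm.injective.ne (hlt i hi).ne')
      have := h1 _ ⟨i, hi, rfl, he⟩
      rw [simpleRefl, swap_mul_eq_mul_swap_symm, swap_comm] at this
      have := BruhatLT.lt_of_mul_swap hc' this
      rw [apply_symm_apply, apply_symm_apply] at this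
      exact this.asymm (hlt i hi)
  · rintro ⟨h1, h2⟩
    refine ⟨?_, ?_⟩
    · rintro _ ⟨i, hi, rfl, he⟩
      rw [simpleRefl, swap_mul_eq_mul_swap_symm]
      exact BruhatLT.mul_swap (h2 _ _ (hlt i hi) he) (by simp)
    · rintro _ ⟨i, hi, rfl, he⟩
      exact BruhatLT.mul_swap (hlt i hi) (h1 _ _ (hlt i hi) he)

/-! ### Multisegments attached to permutations -/

/-- All `[β i, ℓ (u i)]` are segments or of the form `[b, b - 1]`. -/
def Admissible (β ℓ : Fin n → ℤ) (u : Perm (Fin n)) : Prop :=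
  ∀ i, β i ≤ ℓ (u i) + 1

theorem mem_seg {i j : ℤ} {Δ : Segment} : Δ ∈ seg i j ↔ Δ.b = i ∧ Δ.e = j := by
  unfold seg
  split_ifs with h
  · rw [Multiset.mem_singleton, Segment.ext_iff]
  · simp only [Multiset.notMem_zero, false_iff]
    rintro ⟨rfl, rfl⟩
    exact h Δ.le

theorem Segment.seg_eq (Δ : Segment) : seg Δ.b Δ.e = {Δ} := dif_pos Δ.le

theorem mem_ofPerm {β ℓ : Fin n → ℤ} {u : Perm (Fin n)} {Δ : Segment} :
    Δ ∈ ofPerm β ℓ u ↔ ∃ i, Δ.b = β i ∧ Δ.e = ℓ (u i) := by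
  simp [ofPerm, Multiset.mem_sum, mem_seg]

theorem ofPerm_congr {β ℓ : Fin n → ℤ} {u v : Perm (Fin n)} (h : pairs β ℓ u = pairs β ℓ v) :
    ofPerm β ℓ u = ofPerm β ℓ v := by
  have key : ∀ u, ofPerm β ℓ u = ((pairs β ℓ u).map fun p => seg p.1 p.2).sum := fun u => by
    rw [pairs, Multiset.map_map]
    rfl
  rw [key, key, h]

theorem Admissible.congr {β ℓ : Fin n → ℤ} {u v : Perm (Fin n)} (hu : Admissible β ℓ u)
    (h : pairs β ℓ v = pairs β ℓ u) : Admissible β ℓ v := by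
  intro i
  have hi : (β i, ℓ (v i)) ∈ pairs β ℓ u := h ▸ Multiset.mem_map_of_mem _ (mem_univ i)
  obtain ⟨j, -, hj⟩ := Multiset.mem_map.1 hi
  obtain ⟨h1, h2⟩ := Prod.mk.inj hj
  rw [← h1, ← h2]
  exact hu j

/-- The nonempty segments are read off directly. The beginnings left over belong to empty ones,
whose ends admissibility forces to be `b - 1`. -/
theorem pairs_eq_of_ofPerm_eq {β ℓ : Fin n → ℤ} {u v : Perm (Fin n)} (hu : Admissible β ℓ u)
    (hv : Admissible β ℓ v) (h : ofPerm β ℓ u = ofPerm β ℓ v) : pairs β ℓ u = pairs β ℓ v := by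
  have h1 : ∀ u, (pairs β ℓ u).filter (fun p => p.1 ≤ p.2) =
      (ofPerm β ℓ u).map fun Δ => (Δ.b, Δ.e) := by
    intro u
    rw [pairs, ofPerm, Finset.sum_eq_multiset_sum]
    induction (univ : Finset (Fin n)).val using Multiset.induction with
    | empty => rfl
    | cons i s ih =>
      rw [Multiset.map_cons, Multiset.map_cons, Multiset.sum_cons, Multiset.map_add, ← ih,
        Multiset.filter_cons]
      congr 1
      unfold seg
      split_ifs <;> simp
  have h2 : ∀ u, Admissible β ℓ u → (pairs β ℓ u).filter (fun p => ¬ p.1 ≤ p.2) =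
      (((pairs β ℓ u).filter fun p => ¬ p.1 ≤ p.2).map Prod.fst).map fun b => (b, b - 1) := by
    intro u hu
    rw [Multiset.map_map]
    refine (Multiset.map_id _).symm.trans (Multiset.map_congr rfl fun p hp => ?_)
    obtain ⟨hp, hlt⟩ := Multiset.mem_filter.1 hp
    obtain ⟨i, -, rfl⟩ := Multiset.mem_map.1 hp
    have := hu i
    refine Prod.ext rfl ?_
    simp only [id, Function.comp] at hlt ⊢
    omega
  have h3 : ∀ u, ((pairs β ℓ u).filter fun p => p.1 ≤ p.2).map Prod.fst +
      ((pairs β ℓ u).filter fun p => ¬ p.1 ≤ p.2).map Prod.fst = univ.val.map β := by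
    intro u
    rw [← Multiset.map_add, Multiset.filter_add_not, pairs, Multiset.map_map]
    rfl
  have h4 := (h3 u).trans (h3 v).symm
  rw [h1 u, h1 v, h] at h4
  rw [← Multiset.filter_add_not (fun p => p.1 ≤ p.2) (pairs β ℓ u),
    ← Multiset.filter_add_not (fun p => p.1 ≤ p.2) (pairs β ℓ v), h2 u hu, h2 v hv,
    add_left_cancel h4, h1 u, h1 v, h]

theorem ofPerm_mul_swap (β ℓ : Fin n → ℤ) (u : Perm (Fin n)) {i j : Fin n} (hij : i ≠ j) :
    ofPerm β ℓ (u * swap i j) = seg (β i) (ℓ (u j)) + seg (β j) (ℓ (u i)) +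
      ∑ c ∈ (univ.erase i).erase j, seg (β c) (ℓ (u c)) :=
  sum_mul_swap (fun c x => seg (β c) (ℓ x)) u hij

theorem ofPerm_eq_pair_add (β ℓ : Fin n → ℤ) (u : Perm (Fin n)) {i j : Fin n} (hij : i ≠ j) :
    ofPerm β ℓ u = seg (β i) (ℓ (u i)) + seg (β j) (ℓ (u j)) +
      ∑ c ∈ (univ.erase i).erase j, seg (β c) (ℓ (u c)) :=
  sum_eq_pair_add (fun c x => seg (β c) (ℓ x)) u hij

theorem Admissible.mul_swap {β ℓ : Fin n → ℤ} {u : Perm (Fin n)}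
    (hu : Admissible β ℓ u) {i j : Fin n} (h1 : β i ≤ ℓ (u j) + 1) (h2 : β j ≤ ℓ (u i) + 1) :
    Admissible β ℓ (u * swap i j) := by
  intro c
  rw [Perm.mul_apply, swap_apply_def]
  split_ifs with hi hj
  · rwa [hi]
  · rwa [hj]
  · exact hu c

theorem Admissible.of_mul_swap {β ℓ : Fin n → ℤ} (hβ : Monotone β) (hℓ : Monotone ℓ)
    {u : Perm (Fin n)} {i j : Fin n} (hij : i < j) (h : u i < u j)
    (hu : Admissible β ℓ (u * swap i j)) : Admissible β ℓ u := by
  have hj := hu j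
  rw [Perm.mul_apply, swap_apply_right] at hj
  have h1 := hβ hij.le
  have h2 := hℓ h.le
  have := hu.mul_swap (i := i) (j := j) (by simp; omega) (by simp; omega)
  rwa [mul_assoc, swap_mul_self, mul_one] at this

theorem ofPerm_mul_swap_le {β ℓ : Fin n → ℤ} (hβ : Monotone β) (hℓ : Monotone ℓ)
    {u : Perm (Fin n)} {i j : Fin n} (hij : i < j) (h : u i < u j)
    (hu : Admissible β ℓ (u * swap i j)) : ofPerm β ℓ (u * swap i j) ≼ ofPerm β ℓ u := by
  rcases (hβ hij.le).lt_or_eq with hb | hb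
  swap
  · rw [ofPerm_congr (pairs_mul_swap ℓ u hb)]
    exact Relation.ReflTransGen.refl
  rcases (hℓ h.le).lt_or_eq with he | he
  swap
  · rw [ofPerm_mul_swap _ _ _ hij.ne, ofPerm_eq_pair_add _ _ u hij.ne, he]
    exact Relation.ReflTransGen.refl
  -- Admissibility after the swap is the adjacency condition for linkedness; with the strict
  -- inequalities it also makes both original segments nonempty.
  have hj := hu j
  rw [Perm.mul_apply, swap_apply_right] at hj
  refine Relation.ReflTransGen.single
    ⟨∑ c ∈ (univ.erase i).erase j, seg (β c) (ℓ (u c)), ⟨β i, ℓ (u i), by omega⟩,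
      ⟨β j, ℓ (u j), by omega⟩, ⟨hb, he, hj⟩, ?_, ofPerm_mul_swap _ _ _ hij.ne⟩
  rw [ofPerm_eq_pair_add _ _ u hij.ne, ← Segment.seg_eq, ← Segment.seg_eq]

theorem ElemOp.exists_swap {β ℓ : Fin n → ℤ} (hβ : Monotone β) (hℓ : Monotone ℓ)
    {u : Perm (Fin n)} (hu : Admissible β ℓ u) {c : Multisegment} (h : ElemOp (ofPerm β ℓ u) c) :
    ∃ i j, i < j ∧ u i < u j ∧ Admissible β ℓ (u * swap i j) ∧
      c = ofPerm β ℓ (u * swap i j) := by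
  obtain ⟨d, Δ, Δ', ⟨hb, he, hbe⟩, ha, hc⟩ := h
  obtain ⟨i, hi⟩ := mem_ofPerm.1 (show Δ ∈ ofPerm β ℓ u by simp [ha])
  obtain ⟨j, hj⟩ := mem_ofPerm.1 (show Δ' ∈ ofPerm β ℓ u by simp [ha])
  rw [hi.1, hj.1] at hb
  rw [hi.2, hj.2] at he
  have hij : i < j := hβ.reflect_lt hb
  refine ⟨i, j, hij, hℓ.reflect_lt he, hu.mul_swap ?_ ?_, ?_⟩
  · have := hu i
    omega
  · rw [← hi.2, ← hj.1]
    exact hbe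
  · rw [hc, ofPerm_mul_swap _ _ _ hij.ne, hi.1, hi.2, hj.1, hj.2]
    congr 1
    rw [ofPerm_eq_pair_add _ _ u hij.ne, ← hi.1, ← hi.2, ← hj.1, ← hj.2, Segment.seg_eq,
      Segment.seg_eq] at ha
    exact (add_left_cancel ha).symm

theorem exists_bruhatLE_of_le {β ℓ : Fin n → ℤ} (hβ : Monotone β) (hℓ : Monotone ℓ)
    {u : Perm (Fin n)} (hu : Admissible β ℓ u) {c : Multisegment} (h : c ≼ ofPerm β ℓ u) :
    ∃ v, BruhatLE u v ∧ Admissible β ℓ v ∧ c = ofPerm β ℓ v := by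
  induction h with
  | refl => exact ⟨u, Relation.ReflTransGen.refl, hu, rfl⟩
  | tail _ hs ih =>
    obtain ⟨v, huv, hv, rfl⟩ := ih
    obtain ⟨i, j, hij, hlt, had, rfl⟩ := hs.exists_swap hβ hℓ hv
    exact ⟨_, huv.trans (BruhatLE.single v hij hlt), had, rfl⟩

theorem BruhatLE.admissible {β ℓ : Fin n → ℤ} (hβ : Monotone β) (hℓ : Monotone ℓ)
    {u v : Perm (Fin n)} (h : BruhatLE u v) (hv : Admissible β ℓ v) : Admissible β ℓ u := by
  induction h using Relation.ReflTransGen.head_induction_on with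
  | refl => exact hv
  | head hs _ ih =>
    obtain ⟨i, j, hij, hlt, rfl⟩ := exists_lt_of_bruhat_step hs
    exact ih.of_mul_swap hβ hℓ hij hlt

theorem BruhatLE.ofPerm_le {β ℓ : Fin n → ℤ} (hβ : Monotone β) (hℓ : Monotone ℓ)
    {u v : Perm (Fin n)} (h : BruhatLE u v) (hv : Admissible β ℓ v) :
    ofPerm β ℓ v ≼ ofPerm β ℓ u := by
  induction h with
  | refl => exact Relation.ReflTransGen.refl
  | tail _ hs ih =>
    obtain ⟨i, j, hij, hlt, rfl⟩ := exists_lt_of_bruhat_step hs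
    exact (ih (hv.of_mul_swap hβ hℓ hij hlt)).trans (ofPerm_mul_swap_le hβ hℓ hij hlt hv)

theorem IsMinRep.ofPerm_le_iff {β ℓ : Fin n → ℤ} (hβ : Monotone β) (hℓ : Monotone ℓ)
    {u v : Perm (Fin n)} (hu : IsMinRep β ℓ u) (hau : Admissible β ℓ u)
    (hav : Admissible β ℓ v) : ofPerm β ℓ v ≼ ofPerm β ℓ u ↔ BruhatLE u v := by
  refine ⟨fun h => ?_, fun h => h.ofPerm_le hβ hℓ hav⟩
  obtain ⟨v', huv, hv', he⟩ := exists_bruhatLE_of_le hβ hℓ hau h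
  exact huv.congr_right hβ hℓ hu (pairs_eq_of_ofPerm_eq hav hv' he)

theorem IsMinRep.S_ofPerm {β ℓ : Fin n → ℤ} (hβ : Monotone β) (hℓ : Monotone ℓ)
    {w : Perm (Fin n)} (hw : IsMinRep β ℓ w) (haw : Admissible β ℓ w) :
    S (ofPerm β ℓ w) =
      {c | ∃ u, IsMinRep β ℓ u ∧ BruhatLE w u ∧ Admissible β ℓ u ∧ c = ofPerm β ℓ u} := by
  ext c
  constructor
  · intro h
    obtain ⟨u, hwu, hu, rfl⟩ := exists_bruhatLE_of_le hβ hℓ haw h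
    obtain ⟨v, hv, hvu⟩ := exists_isMinRep β ℓ u
    exact ⟨v, hv, hwu.congr_right hβ hℓ hw hvu, hu.congr hvu, (ofPerm_congr hvu).symm⟩
  · rintro ⟨u, -, hwu, hu, rfl⟩
    exact hwu.ofPerm_le hβ hℓ hu

/-! ### The largest admissible permutation -/

/-- Let `j` be the last position of disagreement. Then `u` takes the value `v j` before `j`. If `v j
< u j`, exchanging the two would be allowed for `u`, because `v` is admissible at `j`; hence `u j <
v j`, and by symmetry `v j < u j`. -/
theorem eq_of_maximal_admissible {β ℓ : Fin n → ℤ} {u v : Perm (Fin n)}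
    (hu : Admissible β ℓ u) (hv : Admissible β ℓ v)
    (hu' : ∀ i j, i < j → u i < u j → ¬ β j ≤ ℓ (u i) + 1)
    (hv' : ∀ i j, i < j → v i < v j → ¬ β j ≤ ℓ (v i) + 1) : u = v := by
  by_contra hne
  have hex : ∃ a, u a ≠ v a := by
    by_contra hc
    exact hne (Equiv.ext fun a => by_contra fun ha => hc ⟨a, ha⟩)
  obtain ⟨j, hj, hmax⟩ := WellFounded.has_min (wellFounded_gt (α := Fin n)) {a | u a ≠ v a} hex
  have hup : ∀ c, j < c → u c = v c := fun c hc => by_contra fun hc' => hmax c hc' hc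
  have key : ∀ u v : Perm (Fin n), Admissible β ℓ v →
      (∀ i j, i < j → u i < u j → ¬ β j ≤ ℓ (u i) + 1) → (∀ c, j < c → u c = v c) →
      u j ≠ v j → u j < v j := by
    intro u v hv hu' hup hj
    have hlt : u.symm (v j) < j := by
      refine lt_of_le_of_ne (not_lt.1 fun hlt => ?_) fun he => hj ((symm_apply_eq u).1 he).symm
      have := hup _ hlt
      rw [apply_symm_apply] at this
      exact hlt.ne (v.injective this)
    by_contra hle
    have h1 := hu' _ _ hlt
    rw [apply_symm_apply] at h1
    exact h1 (lt_of_le_of_ne (not_lt.1 hle) hj.symm) (hv j)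
  exact (key u v hv hu' hup hj).asymm (key v u hu hv' (fun c hc => (hup c hc).symm) (Ne.symm hj))

theorem exists_maximal_admissible {β ℓ : Fin n → ℤ} (hℓ : Monotone ℓ)
    (u : Perm (Fin n)) (hu : Admissible β ℓ u) :
    ∃ v, BruhatLE u v ∧ Admissible β ℓ v ∧ ∀ i j, i < j → v i < v j → ¬ β j ≤ ℓ (v i) + 1 := by
  by_cases h : ∀ i j, i < j → u i < u j → ¬ β j ≤ ℓ (u i) + 1
  · exact ⟨u, Relation.ReflTransGen.refl, hu, h⟩
  · push Not at h
    obtain ⟨i, j, hij, hlt, hb⟩ := h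
    have h1 := hu i
    have h2 := hℓ hlt.le
    have := inv_lt_inv_mul_swap u hij hlt
    have := inv_le (u * swap i j)
    obtain ⟨v, huv, hv⟩ := exists_maximal_admissible hℓ (u * swap i j)
      (hu.mul_swap (by omega) hb)
    exact ⟨v, (BruhatLE.single u hij hlt).trans huv, hv⟩
termination_by n * n - inv u

/-- Admissible swaps lead from every admissible permutation up to the same terminal one; `w'` is the
minimal representative with its pairs. -/
theorem exists_greatest_admissible {β ℓ : Fin n → ℤ} (hβ : Monotone β) (hℓ : Monotone ℓ)
    {w : Perm (Fin n)} (hw : Admissible β ℓ w) :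
    ∃ w', IsMinRep β ℓ w' ∧ Admissible β ℓ w' ∧
      ∀ u, IsMinRep β ℓ u → Admissible β ℓ u → BruhatLE u w' := by
  obtain ⟨v, -, hv, hmax⟩ := exists_maximal_admissible hℓ w hw
  obtain ⟨w', hw', he⟩ := exists_isMinRep β ℓ v
  refine ⟨w', hw', hv.congr he, fun u hu hau => ?_⟩
  obtain ⟨v', huv, hv', hmax'⟩ := exists_maximal_admissible hℓ u hau
  rw [eq_of_maximal_admissible hv' hv hmax' hmax] at huv
  exact huv.congr_right hβ hℓ hu he

/-! ### Truncation -/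

theorem deg_add (a b : Multisegment) : deg (a + b) = deg a + deg b := by
  simp [deg]

theorem deg_seg (i j : ℤ) : deg (seg i j) = if i ≤ j then j - i + 1 else 0 := by
  unfold seg
  split_ifs <;> simp [deg]

theorem deg_ofPerm (β ℓ : Fin n → ℤ) (u : Perm (Fin n)) :
    deg (ofPerm β ℓ u) = ∑ i, if β i ≤ ℓ (u i) then ℓ (u i) - β i + 1 else 0 := by
  simp only [ofPerm, ← deg_seg]
  exact map_sum (⟨⟨deg, rfl⟩, deg_add⟩ : Multisegment →+ ℤ) _ _

/-- An absent segment contributes `0` where the right side has `ℓ (u i) - β i + 1 ≤ 0`; equality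
forces all these terms to vanish. -/
theorem deg_ofPerm_eq_iff (β ℓ : Fin n → ℤ) (u : Perm (Fin n)) :
    deg (ofPerm β ℓ u) = ∑ i, ℓ i - ∑ i, β i + n ↔ Admissible β ℓ u := by
  have h1 : ∑ i, ℓ i - ∑ i, β i + n = ∑ i, (ℓ (u i) - β i + 1) := by
    rw [sum_add_distrib, sum_sub_distrib, Equiv.sum_comp u ℓ]
    simp
  rw [deg_ofPerm, h1, eq_comm, sum_eq_sum_iff_of_le]
  · simp only [mem_univ, true_imp_iff]
    refine forall_congr' fun i => ?_
    split_ifs <;> omega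
  · intro i _
    split_ifs <;> omega

/-- The ends after truncation at `k`. -/
def truncEnd (k : ℤ) (ℓ : Fin n → ℤ) (i : Fin n) : ℤ :=
  if ℓ i = k then k - 1 else ℓ i

theorem trunc_ofPerm (k : ℤ) (β ℓ : Fin n → ℤ) (u : Perm (Fin n)) :
    trunc k (ofPerm β ℓ u) = ofPerm β (truncEnd k ℓ) u := by
  have h0 : trunc k (0 : Multisegment) = 0 := Multiset.zero_bind _
  have hadd : ∀ a b, trunc k (a + b) = trunc k a + trunc k b := fun a b => Multiset.add_bind _ _ _
  have h1 : ∀ i j, trunc k (seg i j) = seg i (if j = k then k - 1 else j) := by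
    intro i j
    by_cases hij : i ≤ j
    · rw [seg, dif_pos hij, trunc, Multiset.singleton_bind]
      split_ifs
      · rfl
      · rw [seg, dif_pos hij]
    · rw [seg, dif_neg hij, h0, seg, dif_neg]
      split_ifs <;> omega
  simp only [ofPerm, truncEnd, ← h1]
  exact map_sum (⟨⟨trunc k, h0⟩, hadd⟩ : Multisegment →+ Multisegment) _ _

theorem truncEnd_monotone {k : ℤ} {ℓ : Fin n → ℤ} (hℓ : Monotone ℓ) :
    Monotone (truncEnd k ℓ) := by
  intro i j hij
  have := hℓ hij
  unfold truncEnd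
  split_ifs <;> omega

theorem Admissible.of_truncEnd {k : ℤ} {β ℓ : Fin n → ℤ} {u : Perm (Fin n)}
    (h : Admissible β (truncEnd k ℓ) u) : Admissible β ℓ u := by
  intro i
  have := h i
  unfold truncEnd at this
  split_ifs at this <;> omega

/-- As `k - 1` is not an end beforehand, lowering `k` to `k - 1` can be undone. -/
theorem pairs_eq_of_truncEnd {k : ℤ} {β ℓ : Fin n → ℤ} (hk : ∀ i, ℓ i ≠ k - 1)
    {u v : Perm (Fin n)} (h : pairs β (truncEnd k ℓ) u = pairs β (truncEnd k ℓ) v) :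
    pairs β ℓ u = pairs β ℓ v := by
  have key : ∀ u, pairs β ℓ u = (pairs β (truncEnd k ℓ) u).map
      fun p => (p.1, if p.2 = k - 1 then k else p.2) := by
    intro u
    rw [pairs, pairs, Multiset.map_map]
    refine Multiset.map_congr rfl fun i _ => Prod.ext rfl ?_
    have := hk (u i)
    simp only [Function.comp, truncEnd]
    split_ifs <;> omega
  rw [key, key, h]

theorem SOne_ofPerm {k : ℤ} {β ℓ : Fin n → ℤ} (hβ : Monotone β) (hℓ : Monotone ℓ)
    (hk : ∀ i, ℓ i ≠ k - 1) {w : Perm (Fin n)} (hw : Admissible β (truncEnd k ℓ) w) :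
    SOne (ofPerm β ℓ w) k =
      {c | ∃ u, BruhatLE w u ∧ Admissible β (truncEnd k ℓ) u ∧ c = ofPerm β ℓ u} := by
  have hdeg := (deg_ofPerm_eq_iff β (truncEnd k ℓ) w).2 hw
  ext c
  constructor
  · rintro ⟨hc, hd, -⟩
    obtain ⟨u, hwu, -, rfl⟩ := exists_bruhatLE_of_le hβ hℓ hw.of_truncEnd hc
    rw [trunc_ofPerm, trunc_ofPerm, hdeg, deg_ofPerm_eq_iff] at hd
    exact ⟨u, hwu, hd, rfl⟩
  · rintro ⟨u, hwu, hu, rfl⟩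
    refine ⟨hwu.ofPerm_le hβ hℓ hu.of_truncEnd, ?_, ?_⟩
    · rw [trunc_ofPerm, trunc_ofPerm, hdeg, deg_ofPerm_eq_iff]
      exact hu
    · rintro ⟨Δ, hΔ, -, -, he, -⟩
      obtain ⟨i, -, hi⟩ := mem_ofPerm.1 hΔ
      exact hk _ (hi.symm.trans he)

/-- `TruncChain ks ℓ ℓ'`: successive truncation of the ends `ℓ` at `ks` yields `ℓ'`, and no end
is ever moved to an existing one. -/
inductive TruncChain : List ℤ → (Fin n → ℤ) → (Fin n → ℤ) → Prop
  | nil (ℓ) : TruncChain [] ℓ ℓ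
  | cons {k ks ℓ ℓ'} (hk : ∀ i, ℓ i ≠ k - 1) (h : TruncChain ks (truncEnd k ℓ) ℓ') :
      TruncChain (k :: ks) ℓ ℓ'

namespace TruncChain

theorem append {ks ks' : List ℤ} {ℓ ℓ' ℓ'' : Fin n → ℤ} (h : TruncChain ks ℓ ℓ')
    (h' : TruncChain ks' ℓ' ℓ'') : TruncChain (ks ++ ks') ℓ ℓ'' := by
  induction h with
  | nil => exact h'
  | cons hk _ ih => exact cons hk (ih h')

theorem truncList_ofPerm {ks : List ℤ} {ℓ ℓ' : Fin n → ℤ} (h : TruncChain ks ℓ ℓ')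
    (β : Fin n → ℤ) (u : Perm (Fin n)) : truncList ks (ofPerm β ℓ u) = ofPerm β ℓ' u := by
  induction h with
  | nil => rfl
  | cons _ _ ih => rw [truncList, trunc_ofPerm, ih]

theorem admissible {ks : List ℤ} {ℓ ℓ' : Fin n → ℤ} (h : TruncChain ks ℓ ℓ')
    {β : Fin n → ℤ} {u : Perm (Fin n)} (hu : Admissible β ℓ' u) : Admissible β ℓ u := by
  induction h with
  | nil => exact hu
  | cons _ _ ih => exact (ih hu).of_truncEnd

theorem SList_ofPerm {ks : List ℤ} {ℓ ℓ' : Fin n → ℤ} (h : TruncChain ks ℓ ℓ')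
    {β : Fin n → ℤ} (hβ : Monotone β) (hℓ : Monotone ℓ) {w : Perm (Fin n)}
    (hw : Admissible β ℓ' w) :
    SList ks (ofPerm β ℓ w) =
      {c | ∃ u, BruhatLE w u ∧ Admissible β ℓ' u ∧ c = ofPerm β ℓ u} := by
  induction h with
  | nil ℓ =>
    ext c
    constructor
    · exact exists_bruhatLE_of_le hβ hℓ hw
    · rintro ⟨u, hwu, hu, rfl⟩
      exact hwu.ofPerm_le hβ hℓ hu
  | @cons k ks ℓ ℓ' hk h ih =>
    have ih := ih (truncEnd_monotone hℓ) hw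
    ext c
    rw [SList, SOne_ofPerm hβ hℓ hk (h.admissible hw), trunc_ofPerm, ih]
    constructor
    -- The permutations from the two conditions may differ, but their truncated multisegments agree;
    -- hence so do their pairs, first after and then before truncation.
    · rintro ⟨⟨u, hwu, hu, rfl⟩, u', hwu', hu', he⟩
      rw [trunc_ofPerm] at he
      exact ⟨u', hwu', hu', ofPerm_congr (pairs_eq_of_truncEnd hk
        (pairs_eq_of_ofPerm_eq hu (h.admissible hu') he))⟩
    · rintro ⟨u, hwu, hu, rfl⟩
      exact ⟨⟨u, hwu, h.admissible hu, rfl⟩, u, hwu, hu, trunc_ofPerm _ _ _ _⟩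

end TruncChain

/-- Ends `≥ K` are raised by one. -/
def raiseFrom (ℓ : Fin n → ℤ) (K : ℤ) (i : Fin n) : ℤ := if ℓ i < K then ℓ i else ℓ i + 1

/-- In `raiseFrom ℓ K` the value `K` is free. Truncating at `K + 1` moves the ends that were
originally `K` back there, which frees `K + 1` for the next step. -/
theorem exists_truncChain_raiseFrom (ℓ : Fin n → ℤ) (K : ℤ) (d : ℕ) :
    ∃ ks, TruncChain ks (raiseFrom ℓ K) (raiseFrom ℓ (K + d)) := by
  induction d generalizing K with
  | zero => exact ⟨[], by simpa using TruncChain.nil _⟩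
  | succ d ih =>
    obtain ⟨ks, h⟩ := ih (K + 1)
    refine ⟨(K + 1) :: ks, .cons (fun i => ?_) ?_⟩
    · unfold raiseFrom
      split_ifs <;> omega
    · have h1 : truncEnd (K + 1) (raiseFrom ℓ K) = raiseFrom ℓ (K + 1) := by
        funext i
        unfold truncEnd raiseFrom
        split_ifs <;> omega
      rw [h1]
      convert h using 2
      push_cast
      ring

theorem exists_natAbs_le (f : Fin n → ℤ) : ∃ M : ℕ, ∀ i, |f i| ≤ M := by
  refine ⟨∑ i, (f i).natAbs, fun i => ?_⟩
  rw [Int.abs_eq_natAbs]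
  exact_mod_cast single_le_sum (f := fun i => (f i).natAbs) (fun _ _ => Nat.zero_le _) (mem_univ i)

theorem exists_truncChain_add_one (ℓ : Fin n → ℤ) :
    ∃ ks, TruncChain ks (fun i => ℓ i + 1) ℓ := by
  obtain ⟨M, hM⟩ := exists_natAbs_le ℓ
  -- The threshold runs from `-M`, where every end is raised, to `M + 1`, where none is.
  obtain ⟨ks, h⟩ := exists_truncChain_raiseFrom ℓ (-M) (2 * M + 1)
  have h1 : raiseFrom ℓ (-M) = fun i => ℓ i + 1 := by
    funext i
    have := abs_le.1 (hM i)
    unfold raiseFrom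
    split_ifs <;> omega
  have h2 : raiseFrom ℓ (-M + (2 * M + 1 : ℕ)) = ℓ := by
    funext i
    have := abs_le.1 (hM i)
    unfold raiseFrom
    split_ifs <;> omega
  rw [h1, h2] at h
  exact ⟨ks, h⟩

theorem exists_truncChain_add (ℓ : Fin n → ℤ) (N : ℕ) :
    ∃ ks, TruncChain ks (fun i => ℓ i + N) ℓ := by
  induction N with
  | zero => exact ⟨[], by simpa using TruncChain.nil ℓ⟩
  | succ N ih =>
    obtain ⟨ks, h⟩ := ih
    obtain ⟨ks', h'⟩ := exists_truncChain_add_one fun i => ℓ i + N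
    refine ⟨ks' ++ ks, .append ?_ h⟩
    convert h' using 2
    push_cast
    ring

/-! ### The permutation of a multisegment -/

theorem exists_perm_of_map_eq {f g : Fin n → ℤ} (h : univ.val.map f = univ.val.map g) :
    ∃ σ : Perm (Fin n), ∀ i, g (σ i) = f i := by
  have hc : ∀ (f : Fin n → ℤ) (z : ℤ),
      Fintype.card {i // f i = z} = (univ.val.map f).count z := by
    intro f z
    rw [Fintype.card_subtype, Multiset.count_map]
    simp only [eq_comm]
    rfl
  exact ⟨Equiv.ofFiberEquiv fun z => Fintype.equivOfCardEq (by rw [hc, hc, h]),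
    fun i => Equiv.ofFiberEquiv_map _ i⟩

theorem map_univ_get {α : Type*} (s : List α) {m : ℕ} (h : m = s.length) :
    (univ.val.map fun i : Fin m => s.get (i.cast h)) = s := by
  subst h
  simp [Fin.univ_val_map]

theorem map_univ_beg (a : Multisegment) : univ.val.map (beg a) = a.map Segment.b :=
  (map_univ_get _ _).trans (Multiset.sort_eq _ _)

theorem map_univ_fin (a : Multisegment) : univ.val.map (fin a) = a.map Segment.e :=
  (map_univ_get _ _).trans (Multiset.sort_eq _ _)

theorem beg_monotone (a : Multisegment) : Monotone (beg a) := fun _ _ hij =>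
  (Multiset.pairwise_sort (a.map Segment.b) (· ≤ ·)).sortedLE.monotone_get hij

theorem fin_monotone (a : Multisegment) : Monotone (fin a) := fun _ _ hij =>
  (Multiset.pairwise_sort (a.map Segment.e) (· ≤ ·)).sortedLE.monotone_get hij

/-- For an enumeration of `a`, `σ` matches sorted beginnings with segments and `τ` matches segments
with sorted ends, so `τ * σ` works. -/
theorem exists_eq_ofPerm (a : Multisegment) :
    ∃ w, (∀ i, beg a i ≤ fin a (w i)) ∧ a = ofPerm (beg a) (fin a) w := by
  let f : Fin a.card → Segment := fun i => a.toList.get (i.cast (by simp))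
  have hf : univ.val.map f = a := (map_univ_get _ _).trans (Multiset.coe_toList a)
  obtain ⟨σ, hσ⟩ := exists_perm_of_map_eq (f := beg a) (g := fun i => (f i).b) (by
    rw [map_univ_beg, ← Function.comp_def, ← Multiset.map_map, hf])
  obtain ⟨τ, hτ⟩ := exists_perm_of_map_eq (f := fun i => (f i).e) (g := fin a) (by
    rw [map_univ_fin, ← Function.comp_def Segment.e, ← Multiset.map_map, hf])
  refine ⟨τ * σ, fun i => ?_, ?_⟩
  · rw [Perm.mul_apply, hτ, ← hσ]
    exact (f (σ i)).le
  · have h1 : ofPerm (beg a) (fin a) (τ * σ) = ∑ i, {f (σ i)} := by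
      refine sum_congr rfl fun i _ => ?_
      rw [Perm.mul_apply, hτ, ← hσ, Segment.seg_eq]
    rw [h1, Equiv.sum_comp σ fun i => ({f i} : Multisegment), Finset.sum_eq_multiset_sum,
      ← Function.comp_def singleton f, ← Multiset.map_map, hf, Multiset.sum_map_singleton]

theorem simpleRefl_injective {i j : ℕ} {hi : i + 1 < n} {hj : j + 1 < n}
    (h : simpleRefl i hi = simpleRefl j hj) : i = j := by
  have h1 := congrArg (fun s : Perm (Fin n) => ((s ⟨i, Nat.lt_of_succ_lt hi⟩ : Fin n) : ℕ)) h
  simp only [simpleRefl, swap_apply_left, swap_apply_def, Fin.mk.injEq] at h1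
  split_ifs at h1 <;> simp at h1 <;> omega

/-- The frame with beginnings those of `a` and with the ends of `a` moved to the right by `N`. -/
def shiftFrame (a : Multisegment) (N : ℕ) (hN : ∀ i j, beg a i ≤ fin a j + N) :
    ParabolicFrame a.card (J₁ a) (J₂ a) where
  b := beg a
  e := fun i => fin a i + N
  mono_e := fun _ _ hij => by simpa using fin_monotone a hij
  e_eq_iff := fun i h => by
    rw [add_left_inj]
    refine ⟨fun he => ⟨i, h, rfl, he⟩, ?_⟩
    rintro ⟨j, hj, hs, he⟩
    obtain rfl := simpleRefl_injective hs
    exact he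
  mono_b := beg_monotone a
  b_eq_iff := fun i h => by
    refine ⟨fun he => ⟨i, h, rfl, he⟩, ?_⟩
    rintro ⟨j, hj, hs, he⟩
    obtain rfl := simpleRefl_injective hs
    exact he
  b_le_e := hN

theorem mem_doubleReps_iff_isMinRep (a : Multisegment) (u : Perm (Fin a.card)) :
    u ∈ doubleReps (J₁ a) (J₂ a) ↔ IsMinRep (beg a) (fin a) u :=
  mem_doubleReps_iff (beg_monotone a) (fin_monotone a) u

theorem exists_shift (a : Multisegment) : ∃ N : ℕ, ∀ i j, beg a i ≤ fin a j + N := by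
  obtain ⟨M, hM⟩ := exists_natAbs_le (beg a)
  obtain ⟨M', hM'⟩ := exists_natAbs_le (fin a)
  refine ⟨M + M', fun i j => ?_⟩
  have h1 := abs_le.1 (hM i)
  have h2 := abs_le.1 (hM' j)
  push_cast
  omega

theorem pairs_add_right {β ℓ : Fin n → ℤ} (N : ℤ) {u v : Perm (Fin n)}
    (h : pairs β ℓ u = pairs β ℓ v) :
    pairs β (fun i => ℓ i + N) u = pairs β (fun i => ℓ i + N) v := by
  have key : ∀ u, pairs β (fun i => ℓ i + N) u =
      (pairs β ℓ u).map fun p => (p.1, p.2 + N) := fun u => by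
    rw [pairs, pairs, Multiset.map_map]
    rfl
  rw [key, key, h]

theorem isMinRep_add_right {β ℓ : Fin n → ℤ} (N : ℤ) {u : Perm (Fin n)} :
    IsMinRep β (fun i => ℓ i + N) u ↔ IsMinRep β ℓ u := by
  simp only [IsMinRep, add_left_inj]

/-- A set of admissible minimal representatives parametrizes the set of its multisegments. -/
theorem exists_equiv_ofPerm {β ℓ : Fin n → ℤ} {T : Set Multisegment} {I : Perm (Fin n) → Prop}
    (hβ : Monotone β) (hℓ : Monotone ℓ) (hI : ∀ u, I u → IsMinRep β ℓ u ∧ Admissible β ℓ u)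
    (hT : T = {c | ∃ u, I u ∧ c = ofPerm β ℓ u}) :
    ∃ f : {u // I u} ≃ T, ∀ u, (f u : Multisegment) = ofPerm β ℓ u := by
  subst hT
  refine ⟨Equiv.ofBijective (fun u => ⟨ofPerm β ℓ u.1, u.1, u.2, rfl⟩) ⟨fun u v h => ?_, ?_⟩,
    fun u => rfl⟩
  · exact Subtype.ext ((hI _ u.2).1.eq_of_pairs_eq hβ hℓ (hI _ v.2).1
      (pairs_eq_of_ofPerm_eq (hI _ u.2).2 (hI _ v.2).2 (congrArg Subtype.val h)))
  · rintro ⟨_, u, hu, rfl⟩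
    exact ⟨⟨u, hu⟩, rfl⟩

end Multiseg

/-! ### Assembly of the theorem -/

open Multiseg in
theorem mainTheorem5 (a : Multiseg.Multisegment) :
    ∃ (P : Multiseg.ParabolicFrame a.card (Multiseg.J₁ a) (Multiseg.J₂ a))
      (w : Equiv.Perm (Fin a.card)) (ks : List ℤ),
      -- `w` is the double coset representative attached to `a`
      w ∈ Multiseg.doubleReps (Multiseg.J₁ a) (Multiseg.J₂ a) ∧
      a = Multiseg.ofPerm (Multiseg.beg a) (Multiseg.fin a) w ∧
      -- `a_w` is of parabolic type `(J₁(a), J₂(a))`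
      P.multiseg w ∈ Multiseg.S (P.multiseg 1) ∧
      -- (1) `c ↦ c^(ks)` is an isomorphism of posets from `S(a_w)_ks` to `S(a)`
      (∃ ψ : Multiseg.SList ks (P.multiseg w) ≃ Multiseg.S a,
        (∀ c, (ψ c : Multiseg.Multisegment) = Multiseg.truncList ks c) ∧
        ∀ c d, Multiseg.Le (ψ c).1 (ψ d).1 ↔ Multiseg.Le c.1 d.1) ∧
      -- (2) `S(a_w)_ks` is an upper interval of `S(a_w)`
      ∃ a' ∈ Multiseg.S (P.multiseg w),
        Multiseg.SList ks (P.multiseg w) =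
          {c | c ∈ Multiseg.S (P.multiseg w) ∧ Multiseg.Le a' c} ∧
        -- and `S(a)` is, in the inverse order, the Bruhat interval from `w` to `w'`
        -- in the set of double coset representatives, where `a' = a_{w'}`
        ∃ w' ∈ Multiseg.doubleReps (Multiseg.J₁ a) (Multiseg.J₂ a),
          a' = P.multiseg w' ∧ Multiseg.BruhatLE w w' ∧
          ∃ f : {v : Equiv.Perm (Fin a.card) //
              v ∈ Multiseg.doubleReps (Multiseg.J₁ a) (Multiseg.J₂ a) ∧
                Multiseg.BruhatLE w v ∧ Multiseg.BruhatLE v w'} ≃ Multiseg.S a,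
            (∀ v, (f v : Multiseg.Multisegment) = Multiseg.truncList ks (P.multiseg v)) ∧
            ∀ u v, Multiseg.BruhatLE u.1 v.1 ↔
              Multiseg.Le (f v).1 (f u).1 := by
  obtain ⟨N, hN⟩ := exists_shift a
  obtain ⟨w₀, hw₀, ha₀⟩ := exists_eq_ofPerm a
  obtain ⟨w, hw, hww₀⟩ := exists_isMinRep (beg a) (fin a) w₀
  have hβ := beg_monotone a
  have hℓ := fin_monotone a
  have haw : Admissible (beg a) (fin a) w :=
    Admissible.congr (fun i => (hw₀ i).trans (by omega)) hww₀
  have ha : a = ofPerm (beg a) (fin a) w := ha₀.trans (ofPerm_congr hww₀).symm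
  obtain ⟨w', hw', haw', hmax⟩ := exists_greatest_admissible hβ hℓ haw
  obtain ⟨ks, hks⟩ := exists_truncChain_add (fin a) N
  let P := shiftFrame a N hN
  have hE : Monotone P.e := P.mono_e
  have hminE : ∀ {u}, IsMinRep (beg a) P.e u ↔ IsMinRep (beg a) (fin a) u :=
    isMinRep_add_right (N : ℤ)
  have hadE : ∀ u, Admissible (beg a) P.e u := fun u i =>
    (hN i (u i)).trans (by simp [P, shiftFrame])
  have htr : ∀ u, truncList ks (P.multiseg u) = ofPerm (beg a) (fin a) u :=
    fun u => hks.truncList_ofPerm (beg a) u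
  let I : Equiv.Perm (Fin a.card) → Prop := fun v =>
    v ∈ doubleReps (J₁ a) (J₂ a) ∧ BruhatLE w v ∧ BruhatLE v w'
  have hI : ∀ u, I u ↔
      IsMinRep (beg a) (fin a) u ∧ BruhatLE w u ∧ Admissible (beg a) (fin a) u := by
    intro u
    simp only [I, mem_doubleReps_iff_isMinRep]
    -- Lying below `w'` is the same as being admissible for the original ends.
    exact ⟨fun h => ⟨h.1, h.2.1, h.2.2.admissible hβ hℓ haw'⟩,
      fun h => ⟨h.1, h.2.1, hmax u h.1 h.2.2⟩⟩
  have hSL : SList ks (P.multiseg w) = {c | ∃ u, I u ∧ c = P.multiseg u} := by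
    refine (hks.SList_ofPerm hβ hE haw).trans ?_
    ext c
    constructor
    · rintro ⟨u, hwu, hu, rfl⟩
      obtain ⟨v, hv, hvu⟩ := exists_isMinRep (beg a) (fin a) u
      exact ⟨v, (hI v).2 ⟨hv, hwu.congr_right hβ hℓ hw hvu, hu.congr hvu⟩,
        (ofPerm_congr (pairs_add_right (N : ℤ) hvu)).symm⟩
    · rintro ⟨u, hu, rfl⟩
      obtain ⟨-, h1, h2⟩ := (hI u).1 hu
      exact ⟨u, h1, h2, rfl⟩
  have hS : S a = {c | ∃ u, I u ∧ c = ofPerm (beg a) (fin a) u} := by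
    have h := hw.S_ofPerm hβ hℓ haw
    rw [← ha] at h
    rw [h]
    simp only [hI, and_assoc]
  -- The interval parametrizes both sets, by `f` with the original ends and by `g` with the shifted
  -- ones; truncation is `f` after the inverse of `g`.
  obtain ⟨f, hf⟩ := exists_equiv_ofPerm hβ hℓ (fun u hu => ⟨((hI u).1 hu).1, ((hI u).1 hu).2.2⟩) hS
  obtain ⟨g, hg⟩ := exists_equiv_ofPerm hβ hE
    (fun u hu => ⟨hminE.2 ((hI u).1 hu).1, hadE u⟩) hSL
  have hfle : ∀ u v, BruhatLE u.1 v.1 ↔ Le (f v).1 (f u).1 := fun u v => by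
    rw [hf, hf]
    exact (((hI _).1 u.2).1.ofPerm_le_iff hβ hℓ ((hI _).1 u.2).2.2 ((hI _).1 v.2).2.2).symm
  have hgle : ∀ u v, BruhatLE u.1 v.1 ↔ Le (g v).1 (g u).1 := fun u v => by
    rw [hg, hg]
    exact ((hminE.2 ((hI _).1 u.2).1).ofPerm_le_iff hβ hE (hadE _) (hadE _)).symm
  have hww' : BruhatLE w w' := hmax w hw haw
  refine ⟨P, w, ks, (mem_doubleReps_iff_isMinRep a w).2 hw, ha,
    (one_bruhatLE w).ofPerm_le hβ hE (hadE w), ⟨g.symm.trans f, fun c => ?_, fun c d => ?_⟩,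
    P.multiseg w', hww'.ofPerm_le hβ hE (hadE w'), ?_, w',
    (mem_doubleReps_iff_isMinRep a w').2 hw', rfl, hww', f, fun v => ?_, hfle⟩
  · obtain ⟨u, rfl⟩ := g.surjective c
    rw [Equiv.trans_apply, Equiv.symm_apply_apply, hf, hg]
    exact (htr u.1).symm
  · obtain ⟨u, rfl⟩ := g.surjective c
    obtain ⟨v, rfl⟩ := g.surjective d
    rw [Equiv.trans_apply, Equiv.trans_apply, Equiv.symm_apply_apply, Equiv.symm_apply_apply,
      ← hfle, ← hgle]
  · rw [hSL]
    have h := (hminE.2 hw).S_ofPerm hβ hE (hadE w)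
    ext c
    constructor
    · rintro ⟨u, hu, rfl⟩
      exact ⟨hu.2.1.ofPerm_le hβ hE (hadE u), hu.2.2.ofPerm_le hβ hE (hadE w')⟩
    · rintro ⟨hc, hle⟩
      obtain ⟨u, hu, hwu, -, rfl⟩ := h.subset hc
      exact ⟨u, ⟨(mem_doubleReps_iff_isMinRep a u).2 (hminE.1 hu), hwu,
        (hu.ofPerm_le_iff hβ hE (hadE u) (hadE w')).1 hle⟩, rfl⟩
  · rw [hf]
    exact (htr v.1).symm
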